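/- An almost contact complex Riemannian (accR, or almost contact B-metric) manifold $(M,\varphi,\xi,\eta,g)$ is a smooth $(2n+1)$-dimensional manifold with a smooth endomorphism field $\varphi$, vector field $\xi$, 1-form $\eta$ and pseudo-Riemannian metric $g$ (of signature $(n+1,n)$) such that $$\varphi\xi=0,\quad \varphi^2=-\mathrm{id}+\eta\otimes\xi,\quad \eta\circ\varphi=0,\quad \eta(\xi)=1,\quad g(\varphi x,\varphi y)=-g(x,y)+\eta(x)\eta(y).$$ Its associated metric is $\tilde g(x,y)=g(x,\varphi y)+\eta(x)\eta(y)$, and it is called cosymplectic (an $\mathcal F_0$-manifold) if $F(x,y,z)=g((\nabla_x\varphi)y,z)$ vanishes, where $\nabla$ is the Levi-Civita connection of $g$. Let $(M,\varphi,\xi,\eta,g)$ be an $\mathcal F_0$-manifold, let $u,v,w$ be smooth functions on $M$, and put $$\bar\xi=e^{-w}\xi,\quad \bar\eta=e^{w}\eta,\quad \bar g=e^{2u}\cos 2v\,g+e^{2u}\sin 2v\,\tilde g+\left(e^{2w}-e^{2u}\cos 2v-e^{2u}\sin 2v\right)\eta\otimes\eta,$$ so that $(M,\varphi,\bar\xi,\bar\eta,\bar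 g)$ is again an accR manifold. Let $\bar R$ be the curvature tensor of $\bar g$, $\bar R(x,y,z,w)=\bar g(\bar\nabla_x\bar\nabla_y z-\bar\nabla_y\bar\nabla_x z-\bar\nabla_{[x,y]}z,\,w)$, let $\bar\rho(y,z)=\bar g^{ij}\bar R(e_i,y,z,e_j)$ be the Ricci tensor, $\bar\tau=\bar g^{ij}\bar\rho(e_i,e_j)$ the scalar curvature and $\bar\tau^*=\bar g^{ij}\bar\rho(e_i,\varphi e_j)$ the $*$-scalar curvature. Suppose that $\bar g$ is an almost Riemann soliton with vertical potential $\bar\vartheta=\bar k\,\bar\xi$, i.e. $\bar\sigma$ and $\bar k$ are smooth functions on $M$, $\bar k$ vanishes nowhere, and $$2\bar R+\bar\sigma\,\bar g\owedge\bar g+\bar g\owedge\mathcal L_{\bar\vartheta}\bar g=0,$$ where $(h\owedge k)(x,y,z,w)=h(y,z)k(x,w)-h(x,z)k(y,w)+k(y,z)h(x,w)-k(x,z)h(y,w)$. (i) If $(M,\varphi,\bar\xi,\bar\eta,\bar g)$ is almost $\eta$-Einstein, i.e. $\bar\rho=a\,\bar g+c\,\bar\eta\otimes\bar\eta$ for some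 functions $a,c$ on $M$, then $$\bar\rho=-\left[2n\bar\sigma+d\bar k(\bar\xi)+(4n-1)\bar k\,du(\bar\xi)\right]\bar g-(2n-1)\left[d\bar k(\bar\xi)-\bar k\,du(\bar\xi)\right]\bar\eta\otimes\bar\eta,$$ $$\bar\tau=-2n\left[(2n+1)\bar\sigma+2\,d\bar k(\bar\xi)+4n\,\bar k\,du(\bar\xi)\right],\qquad \bar\tau^*=0.$$ (ii) If $(M,\varphi,\bar\xi,\bar\eta,\bar g)$ is almost Einstein, i.e. $\bar\rho=a\,\bar g$ for some function $a$ on $M$, then $$\bar\rho=-2n\left[\bar\sigma+2\bar k\,du(\bar\xi)\right]\bar g,\qquad \bar\tau=-2n(2n+1)\left[\bar\sigma+2\bar k\,du(\bar\xi)\right],\qquad \bar\tau^*=0.$$ -/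

import Mathlib

open Bundle FiberBundle VectorField
open scoped Manifold ContDiff Topology

noncomputable section

/-! ### Pseudo-Riemannian metrics and the Levi-Civita connection -/

/-- A smooth pseudo-Riemannian metric on `M`. -/
structure PseudoRiemannianMetric {E : Type*} [NormedAddCommGroup E] [NormedSpace ℝ E] {H : Type*}
    [TopologicalSpace H] (I : ModelWithCorners ℝ E H) (M : Type*) [TopologicalSpace M]
    [ChartedSpace H M] [IsManifold I ∞ M] where
  val (p : M) : TangentSpace I p →L[ℝ] TangentSpace I p →L[ℝ] ℝ
  symm (p : M) (x y : TangentSpace I p) : val p x y = val p y x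
  nondeg (p : M) (x : TangentSpace I p) : (∀ y, val p x y = 0) → x = 0
  smooth : ContMDiff I
    (I.prod 𝓘(ℝ, E →L[ℝ] E →L[ℝ] ℝ)) ∞
    (fun p ↦ TotalSpace.mk' (E →L[ℝ] E →L[ℝ] ℝ)
      (E := fun q : M ↦ TangentSpace I q →L[ℝ] TangentSpace I q →L[ℝ] ℝ) p (val p))

namespace PseudoRiemannianMetric

variable {E : Type*} [NormedAddCommGroup E] [NormedSpace ℝ E] [FiniteDimensional ℝ E] {H : Type*}
    [TopologicalSpace H] {I : ModelWithCorners ℝ E H} {M : Type*} [TopologicalSpace M]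
    [ChartedSpace H M] [IsManifold I ∞ M]
    (g : PseudoRiemannianMetric I M)

/-- The function `g(X,Y)` for vector fields `X`, `Y`. -/
def pair (X Y : Π p : M, TangentSpace I p) (p : M) : ℝ := g.val p (X p) (Y p)

lemma pair_comm (X Y : Π p : M, TangentSpace I p) : g.pair X Y = g.pair Y X :=
  funext fun p ↦ g.symm p _ _

lemma pair_add (X Y Z : Π p : M, TangentSpace I p) :
    g.pair X (Y + Z) = g.pair X Y + g.pair X Z := by
  funext p; simp [pair]

lemma add_pair (X Y Z : Π p : M, TangentSpace I p) :
    g.pair (Y + Z) X = g.pair Y X + g.pair Z X := by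
  funext p; simp [pair]

lemma pair_smul (f : M → ℝ) (X Y : Π p : M, TangentSpace I p) :
    g.pair X (f • Y) = f * g.pair X Y := by
  funext p; simp [pair]

lemma smul_pair (f : M → ℝ) (X Y : Π p : M, TangentSpace I p) :
    g.pair (f • X) Y = f * g.pair X Y := by
  funext p; simp [pair]

lemma mdifferentiableAt_pair {X Y : Π p : M, TangentSpace I p} {p : M}
    (hX : MDiffAt (T% X) p) (hY : MDiffAt (T% Y) p) : MDiffAt (g.pair X Y) p := by
  have hg := (g.smooth.mdifferentiable (by simp)) p
  have := MDifferentiableAt.clm_bundle_apply₂ (F₁ := E)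
    (F₂ := E) (F₃ := ℝ) (E₃ := fun _ : M ↦ ℝ) hg hX hY
  simp only [mdifferentiableAt_totalSpace] at this
  exact this.2

/-- The right-hand side of the Koszul formula for `g(∇_X Y, Z)`. -/
def koszul (X Y Z : Π p : M, TangentSpace I p) (p : M) : ℝ :=
  (1 / 2) * (d% (g.pair Y Z) p (X p) + d% (g.pair X Z) p (Y p) - d% (g.pair X Y) p (Z p)
    + g.val p (mlieBracket I X Y p) (Z p) - g.val p (mlieBracket I X Z p) (Y p)
    - g.val p (mlieBracket I Y Z p) (X p))

lemma koszul_tensorial_left {Y Z : Π p : M, TangentSpace I p} {p : M}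
    (hY : MDiffAt (T% Y) p) (hZ : MDiffAt (T% Z) p) :
    TensorialAt I E (fun X ↦ g.koszul X Y Z p) p where
  smul {f X} hf hX := by
    simp only [koszul, smul_pair, mvfderiv_mul hf (g.mdifferentiableAt_pair hX hZ),
      mvfderiv_mul hf (g.mdifferentiableAt_pair hX hY), mlieBracket_smul_left hf hX]
    simp [pair, g.symm p (Z p) (Y p)]
    ring
  add {X X'} hX hX' := by
    simp only [koszul, add_pair, mvfderiv_add (g.mdifferentiableAt_pair hX hZ)
      (g.mdifferentiableAt_pair hX' hZ), mvfderiv_add (g.mdifferentiableAt_pair hX hY)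
      (g.mdifferentiableAt_pair hX' hY), mlieBracket_add_left hX hX']
    simp
    ring

lemma koszul_tensorial_right {X Y : Π p : M, TangentSpace I p} {p : M}
    (hX : MDiffAt (T% X) p) (hY : MDiffAt (T% Y) p) :
    TensorialAt I E (fun Z ↦ g.koszul X Y Z p) p where
  smul {f Z} hf hZ := by
    simp only [koszul, pair_smul, mvfderiv_mul hf (g.mdifferentiableAt_pair hX hZ),
      mvfderiv_mul hf (g.mdifferentiableAt_pair hY hZ), mlieBracket_smul_right hf hZ]
    simp [pair, g.symm p (Z p)]
    ring
  add {Z Z'} hZ hZ' := by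
    simp only [koszul, pair_add, mvfderiv_add (g.mdifferentiableAt_pair hX hZ)
      (g.mdifferentiableAt_pair hX hZ'), mvfderiv_add (g.mdifferentiableAt_pair hY hZ)
      (g.mdifferentiableAt_pair hY hZ'), mlieBracket_add_right hZ hZ']
    simp
    ring

lemma koszul_add {X Y Y' Z : Π p : M, TangentSpace I p} {p : M}
    (hX : MDiffAt (T% X) p) (hY : MDiffAt (T% Y) p) (hY' : MDiffAt (T% Y') p)
    (hZ : MDiffAt (T% Z) p) :
    g.koszul X (Y + Y') Z p = g.koszul X Y Z p + g.koszul X Y' Z p := by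
  simp only [koszul, pair_add, add_pair, mvfderiv_add (g.mdifferentiableAt_pair hX hY)
      (g.mdifferentiableAt_pair hX hY'), mvfderiv_add (g.mdifferentiableAt_pair hY hZ)
      (g.mdifferentiableAt_pair hY' hZ), mlieBracket_add_right hY hY',
      mlieBracket_add_left hY hY']
  simp
  ring

lemma koszul_leibniz {f : M → ℝ} {X Y Z : Π p : M, TangentSpace I p} {p : M}
    (hf : MDiffAt f p) (hX : MDiffAt (T% X) p) (hY : MDiffAt (T% Y) p)
    (hZ : MDiffAt (T% Z) p) :
    g.koszul X (f • Y) Z p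
      = f p * g.koszul X Y Z p + d% f p (X p) * g.val p (Y p) (Z p) := by
  simp only [koszul, pair_smul, smul_pair, mvfderiv_mul hf (g.mdifferentiableAt_pair hX hY),
      mvfderiv_mul hf (g.mdifferentiableAt_pair hY hZ), mlieBracket_smul_right hf hY,
      mlieBracket_smul_left hf hY]
  simp [pair, g.symm p (X p) (Y p)]
  ring

instance instFiniteDimensionalTangentSpace (p : M) : FiniteDimensional ℝ (TangentSpace I p) :=
  inferInstanceAs (FiniteDimensional ℝ E)

/-- The metric at `p` as a bilinear form. -/
def bilin (p : M) : LinearMap.BilinForm ℝ (TangentSpace I p) :=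
  LinearMap.mk₂ ℝ (fun x y ↦ g.val p x y) (by simp) (by simp) (by simp) (by simp)

lemma bilin_nondegenerate (p : M) : (g.bilin p).Nondegenerate := by
  refine ⟨fun x hx ↦ g.nondeg p x hx, fun x hx ↦ g.nondeg p x fun y ↦ ?_⟩
  rw [g.symm]; exact hx y

/-- Raising an index: the vector dual to a covector with respect to the metric. -/
def sharp (p : M) :
    (TangentSpace I p →L[ℝ] ℝ) →L[ℝ] TangentSpace I p :=
  LinearMap.toContinuousLinearMap
    (((g.bilin p).toDual (g.bilin_nondegenerate p)).symm.toLinearMap.comp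
      (ContinuousLinearMap.coeLM ℝ))

lemma val_sharp (p : M) (α : TangentSpace I p →L[ℝ] ℝ) (y : TangentSpace I p) :
    g.val p (g.sharp p α) y = α y :=
  LinearMap.BilinForm.apply_toDual_symm_apply (hB := g.bilin_nondegenerate p) _ _

lemma ext_val (p : M) {x x' : TangentSpace I p} (h : ∀ y, g.val p x y = g.val p x' y) :
    x = x' :=
  sub_eq_zero.1 (g.nondeg p _ fun y ↦ by simp [h y])

open Classical in
/-- The Levi-Civita connection `Y ↦ ∇Y`, defined by the Koszul formula. (Nothing is asked of a
connection at points where the section is not differentiable; the value there is `0`.) -/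
def leviCivitaAux (Y : Π p : M, TangentSpace I p) (p : M) :
    TangentSpace I p →L[ℝ] TangentSpace I p :=
  if hY : MDiffAt (T% Y) p then
    g.sharp p ∘L TensorialAt.mkHom₂ (I := I) (F := E)
      (F' := E) (fun X Z ↦ g.koszul X Y Z p) p
      (fun _ hZ ↦ g.koszul_tensorial_left hY hZ) (fun _ hX ↦ g.koszul_tensorial_right hX hY)
  else 0

lemma val_leviCivitaAux {X Y Z : Π p : M, TangentSpace I p} {p : M}
    (hX : MDiffAt (T% X) p) (hY : MDiffAt (T% Y) p) (hZ : MDiffAt (T% Z) p) :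
    g.val p (g.leviCivitaAux Y p (X p)) (Z p) = g.koszul X Y Z p := by
  rw [leviCivitaAux, dif_pos hY, ContinuousLinearMap.comp_apply, val_sharp]
  exact TensorialAt.mkHom₂_apply _ _ hX hZ

lemma leviCivitaAux_isCovariantDerivativeOn :
    IsCovariantDerivativeOn E g.leviCivitaAux where
  add {Y Y' p} hY hY' _ := by
    ext1 x
    refine g.ext_val p fun z ↦ ?_
    have hx := mdifferentiableAt_extend I E x
    have hz := mdifferentiableAt_extend I E z
    have h := g.koszul_add hx hY hY' hz
    rw [← g.val_leviCivitaAux hx hY hz, ← g.val_leviCivitaAux hx hY' hz,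
      ← g.val_leviCivitaAux hx (mdifferentiableAt_add_section hY hY') hz] at h
    simpa using h
  leibniz {Y f p} hY hf _ := by
    ext1 x
    refine g.ext_val p fun z ↦ ?_
    have hx := mdifferentiableAt_extend I E x
    have hz := mdifferentiableAt_extend I E z
    have h := g.koszul_leibniz hf hx hY hz
    rw [← g.val_leviCivitaAux hx hY hz,
      ← g.val_leviCivitaAux hx (hf.smul_section hY) hz] at h
    simpa using h

/-- The Levi-Civita connection of `g`; the value `∇_x Y` at `p` is `g.leviCivita Y p x`. -/
def leviCivita : CovariantDerivative I E
    (TangentSpace I : M → Type _) :=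
  ⟨g.leviCivitaAux, g.leviCivitaAux_isCovariantDerivativeOn⟩

/-- The Levi-Civita connection is torsion-free. -/
lemma leviCivita_torsion_free {X Y : Π p : M, TangentSpace I p} {p : M}
    (hX : MDiffAt (T% X) p) (hY : MDiffAt (T% Y) p) :
    g.leviCivita Y p (X p) - g.leviCivita X p (Y p) = mlieBracket I X Y p := by
  refine g.ext_val p fun z ↦ ?_
  have hz := mdifferentiableAt_extend I E z
  have h1 := g.val_leviCivitaAux hX hY hz
  have h2 := g.val_leviCivitaAux hY hX hz
  simp only [extend_apply_self] at h1 h2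
  rw [map_sub, sub_apply]
  erw [h1, h2]
  simp only [koszul, g.pair_comm Y X, mlieBracket_swap_apply (V := Y) (W := X)]
  simp
  ring

/-- The Levi-Civita connection is compatible with the metric. -/
lemma leviCivita_metric {X Y Z : Π p : M, TangentSpace I p} {p : M}
    (hX : MDiffAt (T% X) p) (hY : MDiffAt (T% Y) p) (hZ : MDiffAt (T% Z) p) :
    d% (g.pair Y Z) p (X p)
      = g.val p (g.leviCivita Y p (X p)) (Z p) + g.val p (Y p) (g.leviCivita Z p (X p)) := by
  have h1 := g.val_leviCivitaAux hX hY hZ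
  have h2 := g.val_leviCivitaAux hX hZ hY
  rw [g.symm p (Y p)]
  erw [h1, h2]
  simp only [koszul, g.pair_comm Z Y, mlieBracket_swap_apply (V := Z) (W := Y)]
  simp
  ring

end PseudoRiemannianMetric

/-! ### Curvature -/

namespace PseudoRiemannianMetric

variable {E : Type*} [NormedAddCommGroup E] [NormedSpace ℝ E] [FiniteDimensional ℝ E] {H : Type*}
    [TopologicalSpace H] {I : ModelWithCorners ℝ E H} {M : Type*} [TopologicalSpace M]
    [ChartedSpace H M] [IsManifold I ∞ M] (g : PseudoRiemannianMetric I M)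

/-- The curvature tensor of type `(1,3)`:
`R(X,Y)Z = ∇_X ∇_Y Z - ∇_Y ∇_X Z - ∇_[X,Y] Z` at the point `p`. -/
def curvature (X Y Z : Π p : M, TangentSpace I p) (p : M) : TangentSpace I p :=
  g.leviCivita (fun q ↦ g.leviCivita Z q (Y q)) p (X p)
    - g.leviCivita (fun q ↦ g.leviCivita Z q (X q)) p (Y p)
    - g.leviCivita Z p (mlieBracket I X Y p)

/-- The curvature tensor of type `(0,4)`: `R(X,Y,Z,W) = g(R(X,Y)Z, W)`. -/
def riemann (X Y Z W : Π p : M, TangentSpace I p) (p : M) : ℝ :=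
  g.val p (g.curvature X Y Z p) (W p)

/-- The Gram matrix `g_{ij} = g(e_i, e_j)` in a basis `e` of the tangent space at `p`. -/
def gram (p : M) : Matrix (Fin (Module.finrank ℝ (TangentSpace I p)))
    (Fin (Module.finrank ℝ (TangentSpace I p))) ℝ :=
  Matrix.of fun i j ↦
    g.val p (Module.finBasis ℝ (TangentSpace I p) i) (Module.finBasis ℝ (TangentSpace I p) j)

/-- The metric trace `g^{ij} B(e_i, e_j)` of a bilinear form `B` on the tangent space at `p`. -/
def metricTrace (p : M) (B : TangentSpace I p → TangentSpace I p → ℝ) : ℝ :=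
  ∑ i, ∑ j, (g.gram p)⁻¹ i j *
    B (Module.finBasis ℝ (TangentSpace I p) i) (Module.finBasis ℝ (TangentSpace I p) j)

/-- The Ricci tensor `ρ(y,z) = g^{ij} R(e_i, y, z, e_j)`. The curvature tensor is evaluated on
tangent vectors at `p` by extending them to vector fields that are smooth near `p`. -/
def ricci (p : M) (y z : TangentSpace I p) : ℝ :=
  g.metricTrace p fun a b ↦
    g.riemann (extend E a) (extend E y) (extend E z) (extend E b) p

/-- The scalar curvature `τ = g^{ij} ρ(e_i, e_j)`. -/
def scalarCurvature (p : M) : ℝ := g.metricTrace p (g.ricci p)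

/-- The Lie derivative of the metric:
`(L_V g)(X,Y) = V(g(X,Y)) - g([V,X],Y) - g(X,[V,Y])`. -/
def lieDerivative (V X Y : Π p : M, TangentSpace I p) (p : M) : ℝ :=
  d% (g.pair X Y) p (V p) - g.val p (mlieBracket I V X p) (Y p)
    - g.val p (X p) (mlieBracket I V Y p)

end PseudoRiemannianMetric

/-- The Kulkarni–Nomizu product of two tensors of type `(0,2)`, as operations on vector fields. -/
def kulkarniNomizu {M : Type*} {V : M → Type*} (h k : (Π p, V p) → (Π p, V p) → M → ℝ)
    (X Y Z W : Π p, V p) (p : M) : ℝ :=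
  h Y Z p * k X W p - h X Z p * k Y W p + k Y Z p * h X W p - k X Z p * h Y W p

/-! ### Almost contact complex Riemannian structures -/

section Smoothness

variable {E : Type*} [NormedAddCommGroup E] [NormedSpace ℝ E] {H : Type*}
    [TopologicalSpace H] {I : ModelWithCorners ℝ E H} {M : Type*} [TopologicalSpace M]
    [ChartedSpace H M] [IsManifold I ∞ M]

/-- Precomposing a smooth field of bilinear forms with a smooth field of endomorphisms gives a
smooth field of bilinear forms. -/
lemma contMDiff_bilin_comp_endo
    {B : Π p : M, TangentSpace I p →L[ℝ] TangentSpace I p →L[ℝ] ℝ}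
    {φ : Π p : M, TangentSpace I p →L[ℝ] TangentSpace I p}
    (hB : ContMDiff I (I.prod 𝓘(ℝ, E →L[ℝ] E →L[ℝ] ℝ)) ∞
      (fun p ↦ TotalSpace.mk' (E →L[ℝ] E →L[ℝ] ℝ)
        (E := fun q : M ↦ TangentSpace I q →L[ℝ] TangentSpace I q →L[ℝ] ℝ) p (B p)))
    (hφ : ContMDiff I (I.prod 𝓘(ℝ, E →L[ℝ] E)) ∞
      (fun p ↦ TotalSpace.mk' (E →L[ℝ] E)
        (E := fun q : M ↦ TangentSpace I q →L[ℝ] TangentSpace I q) p (φ p))) :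
    ContMDiff I (I.prod 𝓘(ℝ, E →L[ℝ] E →L[ℝ] ℝ)) ∞
      (fun p ↦ TotalSpace.mk' (E →L[ℝ] E →L[ℝ] ℝ)
        (E := fun q : M ↦ TangentSpace I q →L[ℝ] TangentSpace I q →L[ℝ] ℝ) p
        ((B p).comp (φ p))) := by
  intro p
  have h1 := (contMDiffAt_hom_bundle _).1 (hB p)
  have h2 := (contMDiffAt_hom_bundle _).1 (hφ p)
  refine (contMDiffAt_hom_bundle _).2 ⟨contMDiffAt_id, ?_⟩
  refine (h1.2.clm_comp h2.2).congr_of_eventuallyEq ?_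
  filter_upwards [(trivializationAt E (TangentSpace I) p).open_baseSet.mem_nhds
    (mem_baseSet_trivializationAt E (TangentSpace I) p)] with q hq
  ext x y
  simp only [ContinuousLinearMap.inCoordinates, ContinuousLinearMap.comp_apply]
  erw [Trivialization.symmL_continuousLinearMapAt _ hq]

end Smoothness

/-- An almost contact complex Riemannian (almost contact B-metric) structure `(φ, ξ, η, g)` on `M`.
Since `φ` is an anti-isometry of `g` on `ker η`, and `ξ` is a unit vector orthogonal to `ker η`,
the signature of `g` is automatically `(n + 1, n)` when `dim M = 2 n + 1`. -/
structure AccRStructure {E : Type*} [NormedAddCommGroup E] [NormedSpace ℝ E] {H : Type*}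
    [TopologicalSpace H] (I : ModelWithCorners ℝ E H) (M : Type*) [TopologicalSpace M]
    [ChartedSpace H M] [IsManifold I ∞ M] where
  /-- the B-metric -/
  metric : PseudoRiemannianMetric I M
  /-- the structure endomorphism -/
  phi (p : M) : TangentSpace I p →L[ℝ] TangentSpace I p
  /-- the Reeb vector field -/
  xi (p : M) : TangentSpace I p
  /-- the dual contact 1-form -/
  eta (p : M) : TangentSpace I p →L[ℝ] ℝ
  phi_smooth : ContMDiff I (I.prod 𝓘(ℝ, E →L[ℝ] E)) ∞
    (fun p ↦ TotalSpace.mk' (E →L[ℝ] E)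
      (E := fun q : M ↦ TangentSpace I q →L[ℝ] TangentSpace I q) p (phi p))
  xi_smooth : ContMDiff I (I.prod 𝓘(ℝ, E)) ∞
    (fun p ↦ TotalSpace.mk' E (E := fun q : M ↦ TangentSpace I q) p (xi p))
  eta_smooth : ContMDiff I (I.prod 𝓘(ℝ, E →L[ℝ] ℝ)) ∞
    (fun p ↦ TotalSpace.mk' (E →L[ℝ] ℝ) (E := fun q : M ↦ TangentSpace I q →L[ℝ] ℝ) p (eta p))
  phi_xi (p : M) : phi p (xi p) = 0
  phi_phi (p : M) (x : TangentSpace I p) : phi p (phi p x) = -x + eta p x • xi p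
  eta_phi (p : M) (x : TangentSpace I p) : eta p (phi p x) = 0
  eta_xi (p : M) : eta p (xi p) = 1
  metric_phi_phi (p : M) (x y : TangentSpace I p) :
    metric.val p (phi p x) (phi p y) = -metric.val p x y + eta p x * eta p y

namespace AccRStructure

variable {E : Type*} [NormedAddCommGroup E] [NormedSpace ℝ E] {H : Type*}
    [TopologicalSpace H] {I : ModelWithCorners ℝ E H} {M : Type*} [TopologicalSpace M]
    [ChartedSpace H M] [IsManifold I ∞ M] (S : AccRStructure I M)

lemma metric_xi (p : M) (x : TangentSpace I p) : S.metric.val p x (S.xi p) = S.eta p x := by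
  have h := S.metric_phi_phi p x (S.xi p)
  rw [S.phi_xi, S.eta_xi] at h
  simp at h
  linarith

lemma metric_phi_left (p : M) (x y : TangentSpace I p) :
    S.metric.val p (S.phi p x) y = S.metric.val p x (S.phi p y) := by
  have h := S.metric_phi_phi p x (S.phi p y)
  rw [S.phi_phi, S.eta_phi, map_add, map_neg, map_smul, S.metric_xi, S.eta_phi] at h
  simp at h
  linarith

/-- The value at `p` of `η ⊗ η`. -/
def etaEta (p : M) : TangentSpace I p →L[ℝ] TangentSpace I p →L[ℝ] ℝ :=
  (S.eta p).smulRight (S.eta p)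

/-- The associated B-metric `g̃(x,y) = g(x, φ y) + η(x) η(y)`. -/
def assocMetric (p : M) : TangentSpace I p →L[ℝ] TangentSpace I p →L[ℝ] ℝ :=
  (ContinuousLinearMap.precomp ℝ (S.phi p)).comp (S.metric.val p) + S.etaEta p

@[simp] lemma etaEta_apply (p : M) (x y : TangentSpace I p) :
    S.etaEta p x y = S.eta p x * S.eta p y := by simp [etaEta]

@[simp] lemma assocMetric_apply (p : M) (x y : TangentSpace I p) :
    S.assocMetric p x y = S.metric.val p x (S.phi p y) + S.eta p x * S.eta p y := by
  simp [assocMetric]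

lemma etaEta_eq (p : M) :
    S.etaEta p = S.metric.val p + ((S.metric.val p).comp (S.phi p)).comp (S.phi p) := by
  ext x y
  simp [S.phi_phi, S.metric.symm p (S.xi p), S.metric_xi]

lemma assocMetric_eq (p : M) :
    S.assocMetric p = (S.metric.val p).comp (S.phi p) + S.etaEta p := by
  ext x y
  simp [S.metric_phi_left]

lemma etaEta_smooth : ContMDiff I (I.prod 𝓘(ℝ, E →L[ℝ] E →L[ℝ] ℝ)) ∞
    (fun p ↦ TotalSpace.mk' (E →L[ℝ] E →L[ℝ] ℝ)
      (E := fun q : M ↦ TangentSpace I q →L[ℝ] TangentSpace I q →L[ℝ] ℝ) p (S.etaEta p)) := by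
  simp only [etaEta_eq]
  exact S.metric.smooth.add_section
    (contMDiff_bilin_comp_endo (contMDiff_bilin_comp_endo S.metric.smooth S.phi_smooth)
      S.phi_smooth)

lemma assocMetric_smooth : ContMDiff I (I.prod 𝓘(ℝ, E →L[ℝ] E →L[ℝ] ℝ)) ∞
    (fun p ↦ TotalSpace.mk' (E →L[ℝ] E →L[ℝ] ℝ)
      (E := fun q : M ↦ TangentSpace I q →L[ℝ] TangentSpace I q →L[ℝ] ℝ) p
      (S.assocMetric p)) := by
  simp only [assocMetric_eq]
  exact (contMDiff_bilin_comp_endo S.metric.smooth S.phi_smooth).add_section S.etaEta_smooth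

/-- The value at `p` of the metric
`ḡ = e^{2u} cos 2v g + e^{2u} sin 2v g̃ + (e^{2w} - e^{2u} cos 2v - e^{2u} sin 2v) η ⊗ η`. -/
def conformalVal (u v w : M → ℝ) (p : M) :
    TangentSpace I p →L[ℝ] TangentSpace I p →L[ℝ] ℝ :=
  (Real.exp (2 * u p) * Real.cos (2 * v p)) • S.metric.val p
    + (Real.exp (2 * u p) * Real.sin (2 * v p)) • S.assocMetric p
    + (Real.exp (2 * w p) - Real.exp (2 * u p) * Real.cos (2 * v p)
        - Real.exp (2 * u p) * Real.sin (2 * v p)) • S.etaEta p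

lemma conformalVal_apply (u v w : M → ℝ) (p : M) (x y : TangentSpace I p) :
    S.conformalVal u v w p x y =
      Real.exp (2 * u p) * Real.cos (2 * v p) * (S.metric.val p x y - S.eta p x * S.eta p y)
      + Real.exp (2 * u p) * Real.sin (2 * v p) * S.metric.val p x (S.phi p y)
      + Real.exp (2 * w p) * (S.eta p x * S.eta p y) := by
  simp [conformalVal]
  ring

lemma conformalVal_nondeg (u v w : M → ℝ) (p : M) (x : TangentSpace I p)
    (h : ∀ y, S.conformalVal u v w p x y = 0) : x = 0 := by
  have hx : S.eta p x = 0 := by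
    have := h (S.xi p)
    rw [conformalVal_apply, S.metric_xi, S.phi_xi, S.eta_xi] at this
    simpa [Real.exp_ne_zero] using this
  refine S.metric.nondeg p x fun y ↦ ?_
  have h1 := h y
  have h2 := h (S.phi p y)
  rw [conformalVal_apply] at h1 h2
  rw [S.phi_phi, map_add, map_neg, map_smul, S.metric_xi] at h2
  simp only [hx, S.eta_phi, smul_eq_mul, mul_zero, zero_mul, sub_zero, add_zero] at h1 h2
  have he := Real.exp_ne_zero (2 * u p)
  have hcs := Real.cos_sq_add_sin_sq (2 * v p)
  have h3 : Real.exp (2 * u p) * S.metric.val p x y = 0 := by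
    linear_combination Real.cos (2 * v p) * h1 - Real.sin (2 * v p) * h2
      - Real.exp (2 * u p) * S.metric.val p x y * hcs
  simpa [he] using h3

/-- The metric `ḡ` of a contact conformal transformation. -/
def conformalMetric (u v w : C^∞⟮I, M; ℝ⟯) : PseudoRiemannianMetric I M where
  val := S.conformalVal u v w
  symm p x y := by
    rw [conformalVal_apply, conformalVal_apply, S.metric.symm p x y, ← S.metric_phi_left p x y,
      S.metric.symm p (S.phi p x) y]
    ring
  nondeg p x h := S.conformalVal_nondeg u v w p x h
  smooth := by
    have hexp : ∀ f : C^∞⟮I, M; ℝ⟯, ContMDiff I 𝓘(ℝ) ∞ (fun p ↦ Real.exp (2 * f p)) :=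
      fun f ↦ (Real.contDiff_exp.comp (contDiff_const.mul contDiff_id)).contMDiff.comp f.contMDiff
    have hcos : ContMDiff I 𝓘(ℝ) ∞ (fun p ↦ Real.cos (2 * v p)) :=
      (Real.contDiff_cos.comp (contDiff_const.mul contDiff_id)).contMDiff.comp v.contMDiff
    have hsin : ContMDiff I 𝓘(ℝ) ∞ (fun p ↦ Real.sin (2 * v p)) :=
      (Real.contDiff_sin.comp (contDiff_const.mul contDiff_id)).contMDiff.comp v.contMDiff
    have hc := (hexp u).mul hcos
    have hs := (hexp u).mul hsin
    exact ((hc.smul_section S.metric.smooth).add_section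
      (hs.smul_section S.assocMetric_smooth)).add_section
        ((((hexp w).sub hc).sub hs).smul_section S.etaEta_smooth)

/-- The contact conformal transformation determined by the functions `u`, `v`, `w`:
`ξ̄ = e^{-w} ξ`, `η̄ = e^w η`, `φ̄ = φ`, and `ḡ` as in `conformalVal`. -/
def contactConformal (u v w : C^∞⟮I, M; ℝ⟯) : AccRStructure I M where
  metric := S.conformalMetric u v w
  phi := S.phi
  xi p := Real.exp (-w p) • S.xi p
  eta p := Real.exp (w p) • S.eta p
  phi_smooth := S.phi_smooth
  xi_smooth := by
    have h : ContMDiff I 𝓘(ℝ) ∞ (fun p ↦ Real.exp (-w p)) :=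
      (Real.contDiff_exp.comp contDiff_neg).contMDiff.comp w.contMDiff
    exact h.smul_section S.xi_smooth
  eta_smooth := by
    have h : ContMDiff I 𝓘(ℝ) ∞ (fun p ↦ Real.exp (w p)) :=
      Real.contDiff_exp.contMDiff.comp w.contMDiff
    exact h.smul_section S.eta_smooth
  phi_xi p := by rw [map_smul, S.phi_xi, smul_zero]
  phi_phi p x := by
    rw [S.phi_phi]
    simp [smul_smul, mul_right_comm, ← Real.exp_add]
  eta_phi p x := by simp [S.eta_phi]
  eta_xi p := by simp [S.eta_xi, ← Real.exp_add]
  metric_phi_phi p x y := by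
    have h : Real.exp (2 * w p) = Real.exp (w p) * Real.exp (w p) := by
      rw [← Real.exp_add]; ring_nf
    change S.conformalVal u v w p _ _ = -S.conformalVal u v w p _ _ + _
    rw [conformalVal_apply, conformalVal_apply, S.metric_phi_phi, S.metric_phi_phi, S.eta_phi,
      S.eta_phi, h]
    simp
    ring

variable [FiniteDimensional ℝ E]

/-- The fundamental tensor `F(X,Y,Z) = g((∇_X φ) Y, Z)`, where
`(∇_X φ) Y = ∇_X (φ Y) - φ (∇_X Y)` and `∇` is the Levi-Civita connection of `g`. -/
def fundamentalTensor (X Y Z : Π p : M, TangentSpace I p) (p : M) : ℝ :=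
  S.metric.val p
    (S.metric.leviCivita (fun q ↦ S.phi q (Y q)) p (X p)
      - S.phi p (S.metric.leviCivita Y p (X p))) (Z p)

/-- The structure is cosymplectic (of class `𝓕₀`): `F = 0`. -/
def IsCosymplectic : Prop :=
  ∀ (p : M) (X Y Z : Π q : M, TangentSpace I q),
    CMDiffAt ∞ (T% X) p → CMDiffAt ∞ (T% Y) p → CMDiffAt ∞ (T% Z) p →
      S.fundamentalTensor X Y Z p = 0

/-- `(g, V, σ)` is an almost Riemann soliton: `2 R + σ g ∧ g + g ∧ L_V g = 0`, where `∧` is the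
Kulkarni–Nomizu product and `σ` is a function. -/
def IsAlmostRiemannSoliton (V : Π p : M, TangentSpace I p) (σ : M → ℝ) : Prop :=
  ∀ (p : M) (X Y Z W : Π q : M, TangentSpace I q),
    CMDiffAt ∞ (T% X) p → CMDiffAt ∞ (T% Y) p → CMDiffAt ∞ (T% Z) p → CMDiffAt ∞ (T% W) p →
      2 * S.metric.riemann X Y Z W p
        + σ p * kulkarniNomizu S.metric.pair S.metric.pair X Y Z W p
        + kulkarniNomizu S.metric.pair (S.metric.lieDerivative V) X Y Z W p = 0

/-- The `*`-scalar curvature `τ* = g^{ij} ρ(e_i, φ e_j)`. -/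
def starScalarCurvature (p : M) : ℝ :=
  S.metric.metricTrace p fun x y ↦ S.metric.ricci p x (S.phi p y)

/-- The Ricci tensor is `ρ = a g + b g̃ + c η ⊗ η` with functions `a`, `b`, `c` on `M`. -/
def IsAlmostEinsteinLikeWith (a b c : M → ℝ) : Prop :=
  ∀ (p : M) (x y : TangentSpace I p), S.metric.ricci p x y =
    a p * S.metric.val p x y + b p * S.assocMetric p x y + c p * (S.eta p x * S.eta p y)

/-- Almost `η`-Einstein: almost Einstein-like with `b = 0`. -/
def IsAlmostEtaEinstein : Prop := ∃ a c : M → ℝ, S.IsAlmostEinsteinLikeWith a 0 c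

/-- Almost Einstein: almost Einstein-like with `b = c = 0`. -/
def IsAlmostEinstein : Prop := ∃ a : M → ℝ, S.IsAlmostEinsteinLikeWith a 0 0

end AccRStructure

end

/-! ### Traces -/

/-- An endomorphism with `A³ = -A` of a real vector space is trace-free: its complex eigenvalues
are purely imaginary. -/
lemma LinearMap.trace_eq_zero_of_cube_eq_neg {V : Type*} [AddCommGroup V] [Module ℝ V]
    [FiniteDimensional ℝ V] (A : V →ₗ[ℝ] V) (hA : ∀ x, A (A (A x)) = -A x) :
    LinearMap.trace ℝ V A = 0 := by
  let b := Module.finBasis ℝ V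
  rw [LinearMap.trace_eq_matrix_trace ℝ b A]
  set N := LinearMap.toMatrix b b A with hN
  have hN3 : N ^ 3 = -N := by
    have h : A ∘ₗ A ∘ₗ A = -A := by ext x; simp [hA]
    have := congrArg (LinearMap.toMatrix b b) h
    rw [LinearMap.toMatrix_comp b b b, LinearMap.toMatrix_comp b b b, map_neg] at this
    rw [pow_succ, pow_two, mul_assoc]
    exact this
  set C := N.map (algebraMap ℝ ℂ) with hC
  have hC3 : C ^ 3 = -C := by
    have := congrArg (fun X ↦ (algebraMap ℝ ℂ).mapMatrix X) hN3
    simpa only [map_pow, map_neg, RingHom.mapMatrix_apply] using this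
  have htr : ((N.trace : ℝ) : ℂ) = C.charpoly.roots.sum := by
    rw [← Matrix.trace_eq_sum_roots_charpoly, hC]
    simp [Matrix.trace]
  have hroot : ∀ z ∈ C.charpoly.roots, z.re = 0 := by
    intro z hz
    have hz' : z ∈ spectrum ℂ C :=
      Matrix.mem_spectrum_iff_isRoot_charpoly.2 (Polynomial.isRoot_of_mem_roots hz)
    have hz3 := spectrum.subset_polynomial_aeval C (Polynomial.X ^ 3 + Polynomial.X)
      ⟨z, hz', rfl⟩
    have h0 : z ^ 3 + z = 0 := by
      simp only [map_add, map_pow, Polynomial.aeval_X, hC3, neg_add_cancel] at hz3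
      have : Nontrivial (Matrix (Fin (Module.finrank ℝ V)) (Fin (Module.finrank ℝ V)) ℂ) := by
        by_contra hn
        rw [not_nontrivial_iff_subsingleton] at hn
        rw [spectrum.of_subsingleton] at hz'
        exact hz'
      simpa using hz3
    have h1 : z * (z * z + 1) = 0 := by linear_combination h0
    rcases mul_eq_zero.1 h1 with h | h
    · simp [h]
    · have hre := congrArg Complex.re h
      have him := congrArg Complex.im h
      simp at hre him
      by_contra hne
      have : z.im = 0 := by
        have : z.re * z.im = 0 := by linarith
        simpa [hne] using this
      rw [this] at hre
      nlinarith [mul_self_nonneg z.re]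
  have := congrArg Complex.re htr
  rw [Complex.ofReal_re] at this
  rw [this, show C.charpoly.roots.sum.re = (C.charpoly.roots.map Complex.reAddGroupHom).sum from
    map_multiset_sum Complex.reAddGroupHom _]
  refine Multiset.sum_eq_zero fun x hx ↦ ?_
  obtain ⟨z, hz, rfl⟩ := Multiset.mem_map.1 hx
  exact hroot z hz

namespace PseudoRiemannianMetric

variable {E : Type*} [NormedAddCommGroup E] [NormedSpace ℝ E] [FiniteDimensional ℝ E] {H : Type*}
    [TopologicalSpace H] {I : ModelWithCorners ℝ E H} {M : Type*} [TopologicalSpace M]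
    [ChartedSpace H M] [IsManifold I ∞ M] (g : PseudoRiemannianMetric I M)

/-- The metric trace of `g(x, A y)` is the trace of `A`. -/
lemma metricTrace_eq_trace {p : M} {B : TangentSpace I p → TangentSpace I p → ℝ}
    (A : TangentSpace I p →ₗ[ℝ] TangentSpace I p) (h : ∀ x y, B x y = g.val p x (A y)) :
    g.metricTrace p B = LinearMap.trace ℝ (TangentSpace I p) A := by
  set b := Module.finBasis ℝ (TangentSpace I p) with hb
  have hG : g.gram p = LinearMap.BilinForm.toMatrix b (g.bilin p) := by
    ext i j
    simp [gram, LinearMap.BilinForm.toMatrix_apply, bilin, hb]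
  have hdet : IsUnit (g.gram p).det := by
    rw [hG, isUnit_iff_ne_zero]
    exact (LinearMap.BilinForm.nondegenerate_iff_det_ne_zero b).1 (g.bilin_nondegenerate p)
  have hsymm : (g.gram p)⁻¹.transpose = (g.gram p)⁻¹ := by
    rw [Matrix.transpose_nonsing_inv]
    congr 1
    ext i j
    exact g.symm p _ _
  have hB : ∀ i j, B (b i) (b j) = (g.gram p * LinearMap.toMatrix b b A) i j := by
    intro i j
    rw [h, Matrix.mul_apply]
    conv_lhs => rw [← b.sum_repr (A (b j)), map_sum]
    refine Finset.sum_congr rfl fun k _ ↦ ?_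
    rw [map_smul, LinearMap.toMatrix_apply, smul_eq_mul, mul_comm]
    rfl
  have : g.metricTrace p B
      = ((g.gram p)⁻¹ * (g.gram p * LinearMap.toMatrix b b A)).trace := by
    simp only [metricTrace, ← hb, hB, Matrix.trace, Matrix.diag_apply]
    rw [Finset.sum_comm]
    refine Finset.sum_congr rfl fun j _ ↦ ?_
    rw [Matrix.mul_apply]
    refine Finset.sum_congr rfl fun i _ ↦ ?_
    rw [← hsymm, Matrix.transpose_apply, hsymm]
  rw [this, ← Matrix.mul_assoc, Matrix.nonsing_inv_mul _ hdet, one_mul,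
    LinearMap.trace_eq_matrix_trace ℝ b]

/-- If the curvature at `p` satisfies `2 R + s g ∧ g + g ∧ L = 0` with `L = g(·, P ·)`, then `2 ρ = -(2 (m - 1) s + tr P) g - (m - 2) L`, where `m` is the dimension. -/
lemma two_mul_ricci_of_riemann_eq {p : M} (s : ℝ)
    (P : TangentSpace I p →ₗ[ℝ] TangentSpace I p)
    (hR : ∀ x y z t : TangentSpace I p,
      2 * g.riemann (extend E x) (extend E y) (extend E z) (extend E t) p
        + s * (2 * (g.val p y z * g.val p x t - g.val p x z * g.val p y t))
        + (g.val p y z * g.val p x (P t) - g.val p x z * g.val p y (P t)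
          + g.val p y (P z) * g.val p x t - g.val p x (P z) * g.val p y t) = 0)
    (y z : TangentSpace I p) :
    2 * g.ricci p y z =
      -(2 * (Module.finrank ℝ E - 1) * s + LinearMap.trace ℝ (TangentSpace I p) P) * g.val p y z
        - (Module.finrank ℝ E - 2) * g.val p y (P z) := by
  let gy : TangentSpace I p →ₗ[ℝ] ℝ := (g.val p y).toLinearMap
  have key := g.metricTrace_eq_trace (p := p)
    (B := fun a b ↦ g.riemann (extend E a) (extend E y) (extend E z) (extend E b) p)
    (-((s * g.val p y z + (1 / 2) * g.val p y (P z)) • LinearMap.id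
        + ((1 / 2 : ℝ) * g.val p y z) • P - s • gy.smulRight z
        - (1 / 2 : ℝ) • (gy ∘ₗ P).smulRight z - (1 / 2 : ℝ) • gy.smulRight (P z)))
    (fun a b ↦ by
      have := hR a y z b
      simp [gy]
      linear_combination (1 / 2) * this)
  rw [ricci, key]
  have hd : Module.finrank ℝ (TangentSpace I p) = Module.finrank ℝ E := rfl
  simp only [map_neg, map_sub, map_add, map_smul, LinearMap.trace_smulRight, LinearMap.trace_id,
    smul_eq_mul, hd]
  simp [gy]
  ring

end PseudoRiemannianMetric

/-! ### The Lie derivative of the transformed metric along the Reeb direction -/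

section

variable {E : Type*} [NormedAddCommGroup E] [NormedSpace ℝ E] {H : Type*}
    [TopologicalSpace H] {I : ModelWithCorners ℝ E H} {M : Type*} [TopologicalSpace M]
    [ChartedSpace H M]

lemma HasDerivAt.mdifferentiableAt_comp {h : ℝ → ℝ} {h' : ℝ} {f : M → ℝ} {p : M}
    (hh : HasDerivAt h h' (f p)) (hf : MDiffAt f p) : MDiffAt (fun q ↦ h (f q)) p :=
  hh.differentiableAt.mdifferentiableAt.comp p hf

lemma HasDerivAt.mvfderiv_comp {h : ℝ → ℝ} {h' : ℝ} {f : M → ℝ} {p : M}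
    (hh : HasDerivAt h h' (f p)) (hf : MDiffAt f p) :
    d% (fun q ↦ h (f q)) p = h' • d% f p := by
  have h1 := mfderiv_comp p hh.differentiableAt.mdifferentiableAt hf
  ext x
  have h2 := congrArg (fun L ↦ L x) h1
  rw [mfderiv_eq_fderiv, hh.hasFDerivAt.fderiv] at h2
  simp only [mvfderiv, ContinuousLinearMap.comp_apply, smul_apply]
  have h3 : mfderiv I 𝓘(ℝ, ℝ) (fun q ↦ h (f q)) p x
      = (ContinuousLinearMap.toSpanSingleton ℝ h') (mfderiv I 𝓘(ℝ, ℝ) f p x) := h2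
  erw [h3]
  exact (mul_comm _ _)

end

namespace AccRStructure

variable {E : Type*} [NormedAddCommGroup E] [NormedSpace ℝ E] [FiniteDimensional ℝ E] {H : Type*}
    [TopologicalSpace H] {I : ModelWithCorners ℝ E H} {M : Type*} [TopologicalSpace M]
    [ChartedSpace H M] [IsManifold I ∞ M] (S : AccRStructure I M)

lemma mdifferentiableAt_phi {Y : Π p : M, TangentSpace I p} {p : M} (hY : MDiffAt (T% Y) p) :
    MDiffAt (T% (fun q ↦ S.phi q (Y q))) p :=
  MDifferentiableAt.clm_bundle_apply (F₁ := E) (F₂ := E) (b := fun q : M ↦ q)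
    (S.phi_smooth.mdifferentiableAt (by simp)) hY

lemma mdifferentiableAt_xi (p : M) : MDiffAt (T% S.xi) p :=
  S.xi_smooth.mdifferentiableAt (by simp)

variable {S}

lemma IsCosymplectic.leviCivita_phi (hS : S.IsCosymplectic) {Y : Π p : M, TangentSpace I p}
    {p : M} (hY : CMDiffAt ∞ (T% Y) p) (x : TangentSpace I p) :
    S.metric.leviCivita (fun q ↦ S.phi q (Y q)) p x = S.phi p (S.metric.leviCivita Y p x) := by
  rw [← sub_eq_zero]
  refine S.metric.nondeg p _ fun z ↦ ?_
  have := hS p (extend E x) Y (extend E z) (contMDiffAt_extend I E x) hY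
    (contMDiffAt_extend I E z)
  simpa [fundamentalTensor] using this

lemma IsCosymplectic.leviCivita_xi (hS : S.IsCosymplectic) {p : M} (x : TangentSpace I p) :
    S.metric.leviCivita S.xi p x = 0 := by
  have h1 := hS.leviCivita_phi S.xi_smooth.contMDiffAt x
  have h0 : (fun q ↦ S.phi q (S.xi q)) = (0 : Π q : M, TangentSpace I q) :=
    funext fun q ↦ S.phi_xi q
  rw [h0, CovariantDerivative.zero] at h1
  have h2 := S.metric.leviCivita_metric (mdifferentiableAt_extend I E x)
    (S.mdifferentiableAt_xi p) (S.mdifferentiableAt_xi p)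
  have h3 : S.metric.pair S.xi S.xi = fun _ ↦ (1 : ℝ) := by
    funext q; rw [PseudoRiemannianMetric.pair, S.metric_xi, S.eta_xi]
  rw [h3, mvfderiv_const, S.metric.symm p (S.xi p), S.metric_xi, extend_apply_self] at h2
  have h4 : S.eta p (S.metric.leviCivita S.xi p x) = 0 := by
    have : (0 : ℝ) = S.eta p (S.metric.leviCivita S.xi p x)
        + S.eta p (S.metric.leviCivita S.xi p x) := h2
    linarith
  have h5 := S.phi_phi p (S.metric.leviCivita S.xi p x)
  rw [← h1, h4] at h5
  simpa using h5

lemma IsCosymplectic.mlieBracket_xi (hS : S.IsCosymplectic) {X : Π p : M, TangentSpace I p}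
    {p : M} (hX : MDiffAt (T% X) p) :
    mlieBracket I S.xi X p = S.metric.leviCivita X p (S.xi p) := by
  rw [← S.metric.leviCivita_torsion_free (S.mdifferentiableAt_xi p) hX, hS.leviCivita_xi, sub_zero]

lemma IsCosymplectic.mvfderiv_eta (hS : S.IsCosymplectic) {X : Π p : M, TangentSpace I p}
    {p : M} (hX : MDiffAt (T% X) p) :
    d% (fun q ↦ S.eta q (X q)) p (S.xi p) = S.eta p (S.metric.leviCivita X p (S.xi p)) := by
  have h : (fun q ↦ S.eta q (X q)) = S.metric.pair X S.xi :=
    funext fun q ↦ (S.metric_xi q _).symm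
  rw [h, S.metric.leviCivita_metric (S.mdifferentiableAt_xi p) hX (S.mdifferentiableAt_xi p),
    hS.leviCivita_xi, map_zero, add_zero, S.metric_xi]

variable (S) in
lemma mdifferentiableAt_eta {X : Π p : M, TangentSpace I p}
    {p : M} (hX : MDiffAt (T% X) p) : MDiffAt (fun q ↦ S.eta q (X q)) p := by
  have h : (fun q ↦ S.eta q (X q)) = S.metric.pair X S.xi :=
    funext fun q ↦ (S.metric_xi q _).symm
  rw [h]
  exact S.metric.mdifferentiableAt_pair hX (S.mdifferentiableAt_xi p)

variable (u v w : C^∞⟮I, M; ℝ⟯)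

/-- The derivative of the transformed metric along `ξ`: the functions `u`, `v`, `w` are the only
contribution, since `g`, `φ`, `η` are parallel along `ξ`. -/
lemma IsCosymplectic.mvfderiv_pair_conformalMetric (hS : S.IsCosymplectic)
    {X Y : Π p : M, TangentSpace I p} {p : M} (hX : MDiffAt (T% X) p)
    (hY : CMDiffAt ∞ (T% Y) p) :
    d% ((S.conformalMetric u v w).pair X Y) p (S.xi p) =
      S.conformalVal u v w p (mlieBracket I S.xi X p) (Y p)
      + S.conformalVal u v w p (X p) (mlieBracket I S.xi Y p)
      + 2 * d% u p (S.xi p) * (S.conformalVal u v w p (X p) (Y p)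
          - Real.exp (2 * w p) * (S.eta p (X p) * S.eta p (Y p)))
      + 2 * d% v p (S.xi p) * S.conformalVal u v w p (X p) (S.phi p (Y p))
      + 2 * d% w p (S.xi p) * (Real.exp (2 * w p) * (S.eta p (X p) * S.eta p (Y p))) := by
  have hY' : MDiffAt (T% Y) p := hY.mdifferentiableAt (by simp)
  have hu : MDiffAt u p := u.contMDiff.mdifferentiableAt (by simp)
  have hv : MDiffAt v p := v.contMDiff.mdifferentiableAt (by simp)
  have hw : MDiffAt w p := w.contMDiff.mdifferentiableAt (by simp)
  have hexp : ∀ t : ℝ, HasDerivAt (fun s : ℝ ↦ Real.exp (2 * s)) (2 * Real.exp (2 * t)) t :=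
    fun t ↦ by simpa [mul_comm] using ((hasDerivAt_id t).const_mul 2).exp
  have hcos : ∀ t : ℝ, HasDerivAt (fun s : ℝ ↦ Real.cos (2 * s)) (-(2 * Real.sin (2 * t))) t :=
    fun t ↦ by simpa [mul_comm] using ((hasDerivAt_id t).const_mul 2).cos
  have hsin : ∀ t : ℝ, HasDerivAt (fun s : ℝ ↦ Real.sin (2 * s)) (2 * Real.cos (2 * t)) t :=
    fun t ↦ by simpa [mul_comm] using ((hasDerivAt_id t).const_mul 2).sin
  have meu := (hexp (u p)).mdifferentiableAt_comp hu
  have mew := (hexp (w p)).mdifferentiableAt_comp hw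
  have mcv := (hcos (v p)).mdifferentiableAt_comp hv
  have msv := (hsin (v p)).mdifferentiableAt_comp hv
  have mg := S.metric.mdifferentiableAt_pair hX hY'
  have mphi := S.metric.mdifferentiableAt_pair hX (S.mdifferentiableAt_phi hY')
  have mX := S.mdifferentiableAt_eta hX
  have mY := S.mdifferentiableAt_eta hY'
  have hpair : (S.conformalMetric u v w).pair X Y =
      ((fun q ↦ Real.exp (2 * u q)) * (fun q ↦ Real.cos (2 * v q)))
          * (S.metric.pair X Y - (fun q ↦ S.eta q (X q)) * (fun q ↦ S.eta q (Y q)))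
        + ((fun q ↦ Real.exp (2 * u q)) * (fun q ↦ Real.sin (2 * v q)))
          * S.metric.pair X (fun q ↦ S.phi q (Y q))
        + (fun q ↦ Real.exp (2 * w q))
          * ((fun q ↦ S.eta q (X q)) * (fun q ↦ S.eta q (Y q))) :=
    funext fun q ↦ S.conformalVal_apply u v w q _ _
  have dg := S.metric.leviCivita_metric (S.mdifferentiableAt_xi p) hX hY'
  have dphi := S.metric.leviCivita_metric (S.mdifferentiableAt_xi p) hX
    (S.mdifferentiableAt_phi hY')
  rw [hS.leviCivita_phi hY] at dphi
  rw [hpair, mvfderiv_add (((meu.mul mcv).mul (mg.sub (mX.mul mY))).add ((meu.mul msv).mul mphi))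
      (mew.mul (mX.mul mY)),
    mvfderiv_add ((meu.mul mcv).mul (mg.sub (mX.mul mY))) ((meu.mul msv).mul mphi),
    mvfderiv_mul (meu.mul mcv) (mg.sub (mX.mul mY)), mvfderiv_mul (meu.mul msv) mphi,
    mvfderiv_mul mew (mX.mul mY), mvfderiv_mul meu mcv, mvfderiv_mul meu msv,
    mvfderiv_sub mg (mX.mul mY), mvfderiv_mul mX mY,
    (hexp (u p)).mvfderiv_comp hu, (hexp (w p)).mvfderiv_comp hw, (hcos (v p)).mvfderiv_comp hv,
    (hsin (v p)).mvfderiv_comp hv, hS.mlieBracket_xi hX, hS.mlieBracket_xi hY']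
  simp only [add_apply, sub_apply, smul_apply, smul_eq_mul, Pi.mul_apply, Pi.sub_apply, dg, dphi,
    hS.mvfderiv_eta hX, hS.mvfderiv_eta hY', conformalVal_apply, PseudoRiemannianMetric.pair,
    S.phi_phi, S.eta_phi, map_add, map_neg, map_smul, S.metric_xi]
  ring

/-- The Lie derivative of the transformed metric along the vertical field `f ξ`. -/
lemma IsCosymplectic.lieDerivative_conformalMetric (hS : S.IsCosymplectic) {f : M → ℝ}
    {X Y : Π p : M, TangentSpace I p} {p : M} (hf : MDiffAt f p) (hX : MDiffAt (T% X) p)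
    (hY : CMDiffAt ∞ (T% Y) p) :
    (S.conformalMetric u v w).lieDerivative (f • S.xi) X Y p =
      2 * (f p * d% u p (S.xi p)) * (S.conformalVal u v w p (X p) (Y p)
          - Real.exp (2 * w p) * (S.eta p (X p) * S.eta p (Y p)))
      + 2 * (f p * d% v p (S.xi p)) * S.conformalVal u v w p (X p) (S.phi p (Y p))
      + Real.exp (2 * w p) * (2 * (f p * d% w p (S.xi p)) * (S.eta p (X p) * S.eta p (Y p))
        + d% f p (X p) * S.eta p (Y p) + S.eta p (X p) * d% f p (Y p)) := by
  have hxi := S.mdifferentiableAt_xi p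
  have hl : ∀ z, S.conformalVal u v w p (S.xi p) z = Real.exp (2 * w p) * S.eta p z := fun z ↦ by
    rw [conformalVal_apply, S.metric.symm, S.metric_xi, ← S.metric_phi_left, S.phi_xi, S.eta_xi]
    simp
  have hr : ∀ z, S.conformalVal u v w p z (S.xi p) = Real.exp (2 * w p) * S.eta p z := fun z ↦ by
    rw [← hl z]; exact (S.conformalMetric u v w).symm p _ _
  have key := hS.mvfderiv_pair_conformalMetric u v w hX hY
  rw [PseudoRiemannianMetric.lieDerivative, mlieBracket_smul_left hf hxi,
    mlieBracket_smul_left hf hxi]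
  have e : ∀ x y, (S.conformalMetric u v w).val p x y = S.conformalVal u v w p x y :=
    fun _ _ ↦ rfl
  simp only [e, Pi.smul_apply', map_smul, map_add, smul_apply,
    add_apply, smul_eq_mul, key, hl, hr]
  ring

end AccRStructure

namespace AccRStructure

variable {E : Type*} [NormedAddCommGroup E] [NormedSpace ℝ E] [FiniteDimensional ℝ E] {H : Type*}
    [TopologicalSpace H] {I : ModelWithCorners ℝ E H} {M : Type*} [TopologicalSpace M]
    [ChartedSpace H M] [IsManifold I ∞ M]

section Vertical

variable {S : AccRStructure I M} (u v w k : C^∞⟮I, M; ℝ⟯)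

/-- The Lie derivative of the transformed metric along `k ξ̄`, in terms of the transformed
structure. -/
lemma IsCosymplectic.lieDerivative_contactConformal (hS : S.IsCosymplectic)
    {T : AccRStructure I M} (hT : T = S.contactConformal u v w)
    {X Y : Π p : M, TangentSpace I p} {p : M} (hX : MDiffAt (T% X) p)
    (hY : CMDiffAt ∞ (T% Y) p) :
    T.metric.lieDerivative (fun q ↦ k q • T.xi q) X Y p =
      2 * (k p * d% u p (T.xi p)) * (T.metric.val p (X p) (Y p) - T.eta p (X p) * T.eta p (Y p))
      + 2 * (k p * d% v p (T.xi p)) * T.metric.val p (X p) (T.phi p (Y p))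
      + 2 * (k p * d% w p (T.xi p)) * (T.eta p (X p) * T.eta p (Y p))
      + (d% k p (X p) - k p * d% w p (X p)) * T.eta p (Y p)
      + T.eta p (X p) * (d% k p (Y p) - k p * d% w p (Y p)) := by
  subst hT
  have hk : MDiffAt k p := k.contMDiff.mdifferentiableAt (by simp)
  have hw : MDiffAt w p := w.contMDiff.mdifferentiableAt (by simp)
  have hexp : HasDerivAt (fun s : ℝ ↦ Real.exp (-s)) (-Real.exp (-w p)) (w p) := by
    simpa using (hasDerivAt_neg (w p)).exp
  have hm := hexp.mdifferentiableAt_comp hw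
  have hV : (fun q ↦ k q • (S.contactConformal u v w).xi q)
      = (⇑k * fun q ↦ Real.exp (-w q)) • S.xi :=
    funext fun q ↦ smul_smul _ _ _
  have key := hS.lieDerivative_conformalMetric u v w (hk.mul hm) hX hY
  rw [hV]
  refine key.trans ?_
  rw [mvfderiv_mul hk hm, hexp.mvfderiv_comp hw]
  change _ = 2 * (k p * d% u p (Real.exp (-w p) • S.xi p)) * (S.conformalVal u v w p (X p) (Y p)
      - Real.exp (w p) * S.eta p (X p) * (Real.exp (w p) * S.eta p (Y p)))
    + 2 * (k p * d% v p (Real.exp (-w p) • S.xi p)) * S.conformalVal u v w p (X p) (S.phi p (Y p))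
    + 2 * (k p * d% w p (Real.exp (-w p) • S.xi p))
      * (Real.exp (w p) * S.eta p (X p) * (Real.exp (w p) * S.eta p (Y p)))
    + (d% k p (X p) - k p * d% w p (X p)) * (Real.exp (w p) * S.eta p (Y p))
    + Real.exp (w p) * S.eta p (X p) * (d% k p (Y p) - k p * d% w p (Y p))
  have h2 : Real.exp (2 * w p) = Real.exp (w p) * Real.exp (w p) := by
    rw [← Real.exp_add]; ring_nf
  have h1 : Real.exp (w p) * Real.exp (-w p) = 1 := by rw [← Real.exp_add]; simp
  simp only [map_smul, add_apply, smul_apply, smul_eq_mul, Pi.mul_apply, h2]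
  linear_combination (Real.exp (w p) * (d% k p (X p) - k p * d% w p (X p)) * S.eta p (Y p)
    + Real.exp (w p) * S.eta p (X p) * (d% k p (Y p) - k p * d% w p (Y p))) * h1

end Vertical

variable (T : AccRStructure I M)

lemma trace_phi (p : M) :
    LinearMap.trace ℝ (TangentSpace I p) (T.phi p : TangentSpace I p →ₗ[ℝ] TangentSpace I p) = 0 :=
  LinearMap.trace_eq_zero_of_cube_eq_neg _ fun x ↦ by
    have := T.phi_phi p (T.phi p x)
    rw [T.eta_phi, zero_smul, add_zero] at this
    exact this

lemma metric_xi_left (p : M) (x : TangentSpace I p) : T.metric.val p (T.xi p) x = T.eta p x := by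
  rw [T.metric.symm, T.metric_xi]

/-- In dimension one the metric is `η ⊗ η`. -/
lemma metric_eq_etaEta_of_finrank_eq_one (h : Module.finrank ℝ E = 1) (p : M)
    (x y : TangentSpace I p) : T.metric.val p x y = T.eta p x * T.eta p y := by
  have hxi : T.xi p ≠ 0 := fun h0 ↦ by simpa [h0] using T.eta_xi p
  have h' : Module.finrank ℝ (TangentSpace I p) = 1 := h
  obtain ⟨r, rfl⟩ := (finrank_eq_one_iff_of_nonzero' (T.xi p) hxi).1 h' x
  simp [T.metric_xi_left, T.eta_xi]

lemma scalarCurvature_of_ricci_eq {p : M} {a c : ℝ}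
    (h : ∀ x y, T.metric.ricci p x y = a * T.metric.val p x y + c * (T.eta p x * T.eta p y)) :
    T.metric.scalarCurvature p = a * Module.finrank ℝ E + c := by
  rw [PseudoRiemannianMetric.scalarCurvature, T.metric.metricTrace_eq_trace
    (a • LinearMap.id + c • (T.eta p).toLinearMap.smulRight (T.xi p))
    (fun x y ↦ by simp [h, T.metric_xi, mul_comm])]
  have hd : Module.finrank ℝ (TangentSpace I p) = Module.finrank ℝ E := rfl
  simp [LinearMap.trace_smulRight, T.eta_xi, hd]

lemma starScalarCurvature_of_ricci_eq {p : M} {a c : ℝ}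
    (h : ∀ x y, T.metric.ricci p x y = a * T.metric.val p x y + c * (T.eta p x * T.eta p y)) :
    T.starScalarCurvature p = 0 := by
  rw [starScalarCurvature, T.metric.metricTrace_eq_trace (a • (T.phi p).toLinearMap)
    (fun x y ↦ by simp [h, T.eta_phi])]
  rw [map_smul, T.trace_phi, smul_zero]

/-- The Ricci tensor on `(ξ, ξ)` and the scalar curvature of an almost Riemann soliton whose
vertical potential `k ξ` is that of a contact conformal transformation of a cosymplectic
structure. -/
lemma IsAlmostRiemannSoliton.ricci_xi_and_scalarCurvature {T : AccRStructure I M}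
    {S : AccRStructure I M} (hS : S.IsCosymplectic) (u v w k : C^∞⟮I, M; ℝ⟯)
    (hT : T = S.contactConformal u v w) {σ : M → ℝ}
    (hsol : T.IsAlmostRiemannSoliton (fun p ↦ k p • T.xi p) σ) (p : M) :
    T.metric.ricci p (T.xi p) (T.xi p) = -((Module.finrank ℝ E - 1)
        * (σ p + k p * d% u p (T.xi p) + d% k p (T.xi p))) ∧
    T.metric.scalarCurvature p = -((Module.finrank ℝ E - 1)
        * (Module.finrank ℝ E * σ p + 2 * (Module.finrank ℝ E - 1) * (k p * d% u p (T.xi p))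
          + 2 * d% k p (T.xi p))) := by
  let μ : TangentSpace I p →L[ℝ] ℝ := d% k p - k p • d% w p
  let P : TangentSpace I p →ₗ[ℝ] TangentSpace I p :=
    (2 * (k p * d% u p (T.xi p))) • (LinearMap.id - (T.eta p).toLinearMap.smulRight (T.xi p))
    + (2 * (k p * d% v p (T.xi p))) • (T.phi p).toLinearMap
    + (2 * (k p * d% w p (T.xi p))) • (T.eta p).toLinearMap.smulRight (T.xi p)
    + (T.eta p).toLinearMap.smulRight (T.metric.sharp p μ)
    + μ.toLinearMap.smulRight (T.xi p)
  have hL : ∀ x y, T.metric.lieDerivative (fun q ↦ k q • T.xi q) (extend E x) (extend E y) p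
      = T.metric.val p x (P y) := fun x y ↦ by
    rw [hS.lieDerivative_contactConformal u v w k hT (mdifferentiableAt_extend I E x)
      (contMDiffAt_extend I E y)]
    simp only [extend_apply_self]
    simp [P, μ, T.metric_xi, T.metric.symm p x (T.metric.sharp p _), T.metric.val_sharp]
    ring
  have hd : Module.finrank ℝ (TangentSpace I p) = Module.finrank ℝ E := rfl
  have hP : LinearMap.trace ℝ (TangentSpace I p) P
      = 2 * (Module.finrank ℝ E - 1) * (k p * d% u p (T.xi p)) + 2 * d% k p (T.xi p) := by
    simp only [P, map_add, map_sub, map_smul, LinearMap.trace_smulRight, LinearMap.trace_id,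
      T.trace_phi, hd]
    simp [← T.metric_xi, T.metric.val_sharp, μ]
    simp [T.metric_xi, T.eta_xi]
    ring
  have hPxi : T.metric.val p (T.xi p) (P (T.xi p)) = 2 * d% k p (T.xi p) := by
    simp [P, μ, T.metric_xi_left, ← T.metric_xi p (T.metric.sharp p _), T.metric.val_sharp,
      T.eta_xi, T.phi_xi]
    ring
  have hric := T.metric.two_mul_ricci_of_riemann_eq (σ p) P (fun x y z t ↦ by
    have := hsol p (extend E x) (extend E y) (extend E z) (extend E t) (contMDiffAt_extend I E x)
      (contMDiffAt_extend I E y) (contMDiffAt_extend I E z) (contMDiffAt_extend I E t)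
    simp only [kulkarniNomizu, hL, PseudoRiemannianMetric.pair, extend_apply_self] at this
    linear_combination this)
  constructor
  · have := hric (T.xi p) (T.xi p)
    rw [hPxi, hP, T.metric_xi, T.eta_xi] at this
    linear_combination (1 / 2) * this
  · rw [PseudoRiemannianMetric.scalarCurvature, T.metric.metricTrace_eq_trace
      ((1 / 2 : ℝ) • ((-(2 * (Module.finrank ℝ E - 1) * σ p
        + LinearMap.trace ℝ (TangentSpace I p) P)) • LinearMap.id
        - ((Module.finrank ℝ E : ℝ) - 2) • P))
      (fun x y ↦ by
        simp only [LinearMap.smul_apply, LinearMap.sub_apply, LinearMap.id_apply, map_smul,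
          map_sub, smul_eq_mul]
        linear_combination (1 / 2) * hric x y)]
    simp only [map_smul, map_sub, LinearMap.trace_id, hP, hd, smul_eq_mul]
    ring

end AccRStructure

theorem mainTheorem9 (n : ℕ) {M : Type*} [TopologicalSpace M]
    [ChartedSpace (EuclideanSpace ℝ (Fin (2 * n + 1))) M] [IsManifold (𝓡 (2 * n + 1)) ∞ M]
    (S : AccRStructure (𝓡 (2 * n + 1)) M) (hS : S.IsCosymplectic)
    (u v w : C^∞⟮𝓡 (2 * n + 1), M; ℝ⟯)
    (T : AccRStructure (𝓡 (2 * n + 1)) M) (hT : T = S.contactConformal u v w)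
    (k σ : C^∞⟮𝓡 (2 * n + 1), M; ℝ⟯) (hk : ∀ p, k p ≠ 0)
    (hsol : T.IsAlmostRiemannSoliton (fun p ↦ k p • T.xi p) σ) :
    (T.IsAlmostEtaEinstein → ∀ p : M,
      (∀ x y : TangentSpace (𝓡 (2 * n + 1)) p,
        T.metric.ricci p x y =
          -(2 * n * σ p + mvfderiv (𝓡 (2 * n + 1)) k p (T.xi p)
              + (4 * n - 1) * k p * mvfderiv (𝓡 (2 * n + 1)) u p (T.xi p)) * T.metric.val p x y
            - (2 * n - 1) * (mvfderiv (𝓡 (2 * n + 1)) k p (T.xi p)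
              - k p * mvfderiv (𝓡 (2 * n + 1)) u p (T.xi p)) * (T.eta p x * T.eta p y)) ∧
      T.metric.scalarCurvature p =
        -(2 * n) * ((2 * n + 1) * σ p + 2 * mvfderiv (𝓡 (2 * n + 1)) k p (T.xi p)
          + 4 * n * k p * mvfderiv (𝓡 (2 * n + 1)) u p (T.xi p)) ∧
      T.starScalarCurvature p = 0) ∧
    (T.IsAlmostEinstein → ∀ p : M,
      (∀ x y : TangentSpace (𝓡 (2 * n + 1)) p,
        T.metric.ricci p x y =
          -(2 * n) * (σ p + 2 * k p * mvfderiv (𝓡 (2 * n + 1)) u p (T.xi p))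
            * T.metric.val p x y) ∧
      T.metric.scalarCurvature p =
        -(2 * n) * (2 * n + 1)
          * (σ p + 2 * k p * mvfderiv (𝓡 (2 * n + 1)) u p (T.xi p)) ∧
      T.starScalarCurvature p = 0) := by
  have hm : Module.finrank ℝ (EuclideanSpace ℝ (Fin (2 * n + 1))) = 2 * n + 1 := by simp
  have base := fun p ↦ hsol.ricci_xi_and_scalarCurvature hS u v w k hT p
  simp only [hm] at base
  push_cast at base
  constructor
  · rintro ⟨a, c, hac⟩ p
    have hρ : ∀ x y, T.metric.ricci p x y
        = a p * T.metric.val p x y + c p * (T.eta p x * T.eta p y) := fun x y ↦ by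
      simpa using hac p x y
    obtain ⟨h1, hτ⟩ := base p
    have h2 := T.scalarCurvature_of_ricci_eq hρ
    rw [hρ, T.metric_xi, T.eta_xi] at h1
    rw [hm, hτ] at h2
    push_cast at h2
    refine ⟨fun x y ↦ ?_, hτ.trans (by ring), T.starScalarCurvature_of_ricci_eq hρ⟩
    rw [hρ]
    rcases Nat.eq_zero_or_pos n with rfl | hn
    · rw [T.metric_eq_etaEta_of_finrank_eq_one (by simp)]
      push_cast at h1 ⊢
      linear_combination (T.eta p x * T.eta p y) * h1
    · have hn' : (2 * n : ℝ) ≠ 0 := by positivity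
      have ha : a p = -(2 * n * σ p + mvfderiv (𝓡 (2 * n + 1)) k p (T.xi p)
          + (4 * n - 1) * k p * mvfderiv (𝓡 (2 * n + 1)) u p (T.xi p)) := by
        refine mul_left_cancel₀ hn' ?_
        linear_combination -h2 - h1
      linear_combination (T.eta p x * T.eta p y) * h1
        + (T.metric.val p x y - T.eta p x * T.eta p y) * ha
  · rintro ⟨a, ha⟩ p
    have hρ : ∀ x y, T.metric.ricci p x y
        = a p * T.metric.val p x y + 0 * (T.eta p x * T.eta p y) := fun x y ↦ by
      simpa using ha p x y
    obtain ⟨h1, hτ⟩ := base p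
    have h2 := T.scalarCurvature_of_ricci_eq hρ
    rw [hρ, T.metric_xi, T.eta_xi] at h1
    rw [hm, hτ] at h2
    push_cast at h2
    have ha' : a p = -(2 * n) * (σ p + 2 * k p * mvfderiv (𝓡 (2 * n + 1)) u p (T.xi p)) := by
      rcases Nat.eq_zero_or_pos n with rfl | hn
      · push_cast at h1 ⊢
        linear_combination h1
      · have hn' : (2 * n - 1 : ℝ) ≠ 0 := by
          have : (1 : ℝ) ≤ n := by exact_mod_cast hn
          linarith
        refine mul_left_cancel₀ hn' ?_
        linear_combination -h2 - 2 * h1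
    refine ⟨fun x y ↦ ?_, ?_, T.starScalarCurvature_of_ricci_eq hρ⟩
    · rw [hρ, ha']; ring
    · rw [hτ]
      linear_combination h2 + (2 * n + 1) * ha'
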